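/- Let $n\ge 1$ be an integer and let $p,q,r,a,\alpha,\beta,\gamma,\sigma$ be real numbers with $$p,q\ge 1,\quad r>0,\quad 0\le a\le 1,\qquad \frac1p+\frac{\alpha}{n}>0,\quad \frac1q+\frac{\beta}{n}>0,\quad \frac1r+\frac{\gamma}{n}>0,$$ $$\gamma=a\sigma+(1-a)\beta,\qquad \frac1r+\frac{\gamma}{n}=a\left(\frac1p+\frac{\alpha-1}{n}\right)+(1-a)\left(\frac1q+\frac{\beta}{n}\right),$$ and $$\frac{1-a}{q}\le\frac1r\le\frac ap+\frac{1-a}{q}.$$ If $a>0$, assume moreover that $$(n-1)\left[\frac1a\left(\frac1r-\frac1q\right)+\frac1q-\frac1p\right]\le\alpha-\sigma\le 0,$$ with strict inequality on the left if $p=1$, and that $$-\frac{\sigma}{n}<\frac1a\left(\frac1r-\frac1q\right)+\frac1q .$$ Then there is a constant $C>0$, depending only on $n,p,q,r,a,\alpha,\beta,\gamma,\sigma$, such that $$\big\||x|^{\gamma}u\big\|_{L^r(\mathbb R^n)}\le C\,\big\||x|^{\alpha}\nabla u\big\|_{L^p(\mathbb R^n)}^{a}\,\big\||x|^{\beta}u\big\|_{L^q(\mathbb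 R^n)}^{1-a}$$ for every radially symmetric, real-valued $u\in C_0^\infty(\mathbb R^n)$ (smooth with compact support, with $u(x)$ depending only on $|x|$). Here $\|f\|_{L^r}=\left(\int|f|^r\right)^{1/r}$ for every $r>0$, and $t^0=1$ for every $t\ge 0$. -/

import Mathlib

open MeasureTheory
open scoped Gradient ContDiff

/-- A function on `ℝⁿ` is radially symmetric if its value depends only on `|x|`. -/
def RadiallySymmetric {n : ℕ} (u : EuclideanSpace ℝ (Fin n) → ℝ) : Prop :=
  ∀ x y : EuclideanSpace ℝ (Fin n), ‖x‖ = ‖y‖ → u x = u y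

/-- The weighted norm `‖ |x|^s f ‖_{L^p(ℝⁿ)}` (Lebesgue measure, `0 < p < ∞`), as an extended
nonnegative real, for a scalar or vector valued function `f`. -/
noncomputable def weightedNorm {n : ℕ} {F : Type*} [NormedAddCommGroup F] [NormedSpace ℝ F]
    (s p : ℝ) (f : EuclideanSpace ℝ (Fin n) → F) : ENNReal :=
  eLpNorm (fun x => (‖x‖ ^ s) • f x) (ENNReal.ofReal p) volume

/-! Put l = α - 1 + n/p; the hypotheses force l > 0 when a > 0. A radial u is a function of one
variable, so the fundamental theorem of calculus and Hölder bound |x|^{lp}|u|^p pointwise by D =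
∫|x|^{αp}|∇u|^p, up to a constant, and Tonelli then gives Hardy's bound for ∫|x|^{lp-n}|u|^p
(`exists_const_radial_hardy`). The integrand |x|^{γr}|u|^r factors into powers κ, 1-η, η of
|x|^{lp}|u|^p, |x|^{lp-n}|u|^p and |x|^{βq}|u|^q. The first factor is bounded pointwise, the other
two by Hölder and Hardy. -/

open Set Measure in
/-- Integration in polar coordinates of a radial function with values in `[0, ∞]`. -/
theorem lintegral_fun_norm {E : Type*} [NormedAddCommGroup E] [NormedSpace ℝ E]
    [FiniteDimensional ℝ E] [Nontrivial E] [MeasurableSpace E] [BorelSpace E]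
    (μ : Measure E) [μ.IsAddHaarMeasure] {f : ℝ → ENNReal} (hf : Measurable f) :
    ∫⁻ x, f ‖x‖ ∂μ = μ.toSphere univ *
      ∫⁻ t in Ioi (0 : ℝ), ENNReal.ofReal (t ^ (Module.finrank ℝ E - 1)) * f t := by
  calc
    ∫⁻ x, f ‖x‖ ∂μ = ∫⁻ x : ({(0)}ᶜ : Set E), f ‖x.1‖ ∂(μ.comap (↑)) := by
      rw [lintegral_subtype_comap (measurableSet_singleton _).compl fun x ↦ f ‖x‖,
        restrict_compl_singleton]
    _ = ∫⁻ x, f x.2 ∂μ.toSphere.prod (.volumeIoiPow (Module.finrank ℝ E - 1)) := by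
      rw [← μ.measurePreserving_homeomorphUnitSphereProd.lintegral_comp_emb
        (Homeomorph.measurableEmbedding _) (fun x ↦ f x.2)]
      simp
    _ = μ.toSphere univ * ∫⁻ x : Ioi (0 : ℝ), f x
          ∂.volumeIoiPow (Module.finrank ℝ E - 1) := by
      rw [lintegral_prod _ (by fun_prop)]
      simp [mul_comm]
    _ = _ := by
      rw [volumeIoiPow, lintegral_withDensity_eq_lintegral_mul _ (by fun_prop) (by fun_prop)]
      simp only [Pi.mul_apply]
      rw [lintegral_subtype_comap measurableSet_Ioi
        fun t : ℝ ↦ ENNReal.ofReal (t ^ (Module.finrank ℝ E - 1)) * f t]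

/-! ### Weighted inequalities on the half-line -/

open Set in
theorem enorm_le_lintegral_Ioi_deriv {f : ℝ → ℝ} (hf : ContDiff ℝ 1 f)
    (hc : HasCompactSupport f) (x : ℝ) : ‖f x‖ₑ ≤ ∫⁻ y in Ioi x, ‖deriv f y‖ₑ := by
  rw [← enorm_neg, ← HasCompactSupport.integral_Ioi_deriv_eq hf hc x]
  exact enorm_integral_le_lintegral_enorm _

open Set in
theorem lintegral_Ioi_ofReal_rpow {l t : ℝ} (hl : 0 < l) (ht : 0 < t) :
    ∫⁻ y in Ioi t, ENNReal.ofReal (y ^ (-(1 + l))) = ENNReal.ofReal (t ^ (-l) / l) := by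
  rw [← ofReal_integral_eq_lintegral_ofReal
    (integrableOn_Ioi_rpow_of_lt (by linarith) ht), integral_Ioi_rpow_of_lt (by linarith) ht]
  · congr 1
    rw [show -(1 + l) + 1 = -l by ring, neg_div_neg_eq]
  · filter_upwards [self_mem_ae_restrict measurableSet_Ioi] with y hy
    exact Real.rpow_nonneg (ht.trans hy).le _

open Set in
theorem lintegral_Ioo_ofReal_rpow {l t : ℝ} (hl : 0 < l) (ht : 0 < t) :
    ∫⁻ y in Ioo 0 t, ENNReal.ofReal (y ^ (l - 1)) = ENNReal.ofReal (t ^ l / l) := by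
  have hi := intervalIntegral.intervalIntegrable_rpow' (a := 0) (b := t) (r := l - 1) (by linarith)
  rw [Measure.restrict_congr_set Ioo_ae_eq_Ioc, ← ofReal_integral_eq_lintegral_ofReal hi.1,
    ← intervalIntegral.integral_of_le ht.le, integral_rpow (Or.inl (by linarith))]
  · congr 1
    rw [sub_add_cancel, Real.zero_rpow hl.ne', sub_zero]
  · filter_upwards [self_mem_ae_restrict measurableSet_Ioc] with y hy
    exact Real.rpow_nonneg hy.1.le _

open Set in
/-- The fundamental theorem of calculus combined with Hölder's inequality. -/
theorem enorm_rpow_le_lintegral_Ioi {f : ℝ → ℝ} (hf : ContDiff ℝ 1 f)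
    (hc : HasCompactSupport f) {p l t : ℝ} (hp : 1 ≤ p) (hl : 0 < l) (ht : 0 < t) :
    ‖f t‖ₑ ^ p ≤ ENNReal.ofReal ((t ^ (-l) / l) ^ (p - 1)) *
      ∫⁻ y in Ioi t, ENNReal.ofReal (y ^ ((1 + l) * (p - 1))) * ‖deriv f y‖ₑ ^ p := by
  have hp0 : 0 < p := by linarith
  have hd : Measurable (deriv f) := measurable_deriv f
  -- Hölder after inserting a power of y and its inverse; l > 0 makes the first integral converge.
  -- For p = 1 its exponent is 0.
  have key : ‖f t‖ₑ ≤ (∫⁻ y in Ioi t, ENNReal.ofReal (y ^ (-(1 + l)))) ^ (1 - 1 / p) *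
      (∫⁻ y in Ioi t, ENNReal.ofReal (y ^ ((1 + l) * (p - 1))) * ‖deriv f y‖ₑ ^ p) ^ (1 / p) := by
    refine (enorm_le_lintegral_Ioi_deriv hf hc t).trans ?_
    refine le_trans (le_of_eq ?_) (ENNReal.lintegral_mul_norm_pow_le (by fun_prop) (by fun_prop)
      (sub_nonneg.2 ((div_le_one hp0).2 hp)) (by positivity) (by ring))
    refine setLIntegral_congr_fun measurableSet_Ioi fun y hy ↦ ?_
    have hy0 : 0 < y := ht.trans hy
    have hpos := fun s ↦ Real.rpow_pos_of_pos hy0 s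
    rw [ENNReal.mul_rpow_of_nonneg _ _ (by positivity), ← ENNReal.rpow_mul,
      mul_one_div_cancel hp0.ne', ENNReal.rpow_one, ENNReal.ofReal_rpow_of_pos (hpos _),
      ENNReal.ofReal_rpow_of_pos (hpos _), ← mul_assoc, ← ENNReal.ofReal_mul (by positivity),
      ← Real.rpow_mul hy0.le, ← Real.rpow_mul hy0.le, ← Real.rpow_add hy0]
    rw [show -(1 + l) * (1 - 1 / p) + (1 + l) * (p - 1) * (1 / p) = 0 by field_simp; ring]
    simp
  rw [lintegral_Ioi_ofReal_rpow hl ht] at key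
  refine (ENNReal.rpow_le_rpow key hp0.le).trans (le_of_eq ?_)
  rw [ENNReal.mul_rpow_of_nonneg _ _ hp0.le, ← ENNReal.rpow_mul, ← ENNReal.rpow_mul,
    one_div_mul_cancel hp0.ne', ENNReal.rpow_one, show (1 - 1 / p) * p = p - 1 by field_simp,
    ENNReal.ofReal_rpow_of_nonneg (by positivity) (by linarith)]

open Set in
/-- Weighted pointwise bound on the half-line. -/
theorem ofReal_rpow_mul_enorm_rpow_le {f : ℝ → ℝ} (hf : ContDiff ℝ 1 f)
    (hc : HasCompactSupport f) {p l t : ℝ} (hp : 1 ≤ p) (hl : 0 < l) (ht : 0 < t) :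
    ENNReal.ofReal (t ^ (l * p)) * ‖f t‖ₑ ^ p ≤ ENNReal.ofReal (l ^ (1 - p)) *
      ∫⁻ y in Ioi (0 : ℝ), ENNReal.ofReal (y ^ ((1 + l) * p - 1)) * ‖deriv f y‖ₑ ^ p := by
  grw [enorm_rpow_le_lintegral_Ioi hf hc hp hl ht, ← mul_assoc,
    ← ENNReal.ofReal_mul (by positivity)]
  have e : t ^ (l * p) * (t ^ (-l) / l) ^ (p - 1) = l ^ (1 - p) * t ^ l := by
    rw [Real.div_rpow (by positivity) hl.le, ← Real.rpow_mul ht.le, mul_div_assoc',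
      ← Real.rpow_add ht, show 1 - p = -(p - 1) by ring, Real.rpow_neg hl.le]
    rw [show l * p + -l * (p - 1) = l by ring]
    field_simp
  rw [e, ENNReal.ofReal_mul (by positivity), mul_assoc]
  gcongr
  rw [← lintegral_const_mul' _ _ ENNReal.ofReal_ne_top]
  refine le_trans ?_ (lintegral_mono_set (Ioi_subset_Ioi ht.le))
  refine setLIntegral_mono' measurableSet_Ioi fun y hy ↦ ?_
  have hy0 : 0 < y := ht.trans hy
  -- The leftover t^l is absorbed by y^l, as t < y.
  rw [← mul_assoc, ← ENNReal.ofReal_mul (by positivity),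
    show (1 + l) * p - 1 = l + (1 + l) * (p - 1) by ring, Real.rpow_add hy0]
  gcongr
  exact (mem_Ioi.1 hy).le

open Set in
/-- Hardy's inequality with power weights on the half-line. -/
theorem lintegral_Ioi_rpow_mul_le_deriv {f : ℝ → ℝ} (hf : ContDiff ℝ 1 f)
    (hc : HasCompactSupport f) {p l : ℝ} (hp : 1 ≤ p) (hl : 0 < l) :
    ∫⁻ t in Ioi (0 : ℝ), ENNReal.ofReal (t ^ (l * p - 1)) * ‖f t‖ₑ ^ p ≤
      ENNReal.ofReal (l ^ (-p)) *
      ∫⁻ y in Ioi (0 : ℝ), ENNReal.ofReal (y ^ ((1 + l) * p - 1)) * ‖deriv f y‖ₑ ^ p := by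
  have hd : Measurable (deriv f) := measurable_deriv f
  set G : ℝ → ENNReal := fun y ↦ ENNReal.ofReal (y ^ ((1 + l) * (p - 1))) * ‖deriv f y‖ₑ ^ p
    with hG
  have hGm : Measurable G := by fun_prop
  calc
    -- The constraint t < y becomes an indicator, so that Tonelli leaves the inner integral of
    -- t^(l-1) over (0, y), equal to y^l / l.
    _ ≤ ∫⁻ t in Ioi (0 : ℝ), ∫⁻ y in Ioi (0 : ℝ), ENNReal.ofReal (l ^ (1 - p)) *
          ((Iio y).indicator (fun t ↦ ENNReal.ofReal (t ^ (l - 1))) t * G y) := by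
      refine setLIntegral_mono' measurableSet_Ioi fun t (ht : 0 < t) ↦ ?_
      grw [enorm_rpow_le_lintegral_Ioi hf hc hp hl ht, ← mul_assoc,
        ← ENNReal.ofReal_mul (by positivity)]
      have e : t ^ (l * p - 1) * (t ^ (-l) / l) ^ (p - 1) = l ^ (1 - p) * t ^ (l - 1) := by
        rw [Real.div_rpow (by positivity) hl.le, ← Real.rpow_mul ht.le, mul_div_assoc',
          ← Real.rpow_add ht, show 1 - p = -(p - 1) by ring, Real.rpow_neg hl.le]
        rw [show l * p - 1 + -l * (p - 1) = l - 1 by ring]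
        field_simp
      rw [e, ENNReal.ofReal_mul (by positivity), lintegral_const_mul' _ _ ENNReal.ofReal_ne_top,
        mul_assoc]
      gcongr
      rw [← lintegral_const_mul' _ _ ENNReal.ofReal_ne_top, ← lintegral_indicator measurableSet_Ioi,
        ← lintegral_indicator measurableSet_Ioi]
      refine lintegral_mono fun y ↦ ?_
      by_cases hy : t < y
      · simp [indicator, hy, ht.trans hy, hG]
      · simp [indicator, hy]
    _ = ∫⁻ y in Ioi (0 : ℝ), ∫⁻ t in Ioi (0 : ℝ), ENNReal.ofReal (l ^ (1 - p)) *
          ((Iio y).indicator (fun t ↦ ENNReal.ofReal (t ^ (l - 1))) t * G y) := by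
      refine lintegral_lintegral_swap (Measurable.aemeasurable ?_)
      refine measurable_const.mul (Measurable.mul ?_ (hGm.comp measurable_snd))
      have : (fun z : ℝ × ℝ ↦ (Iio z.2).indicator (fun t ↦ ENNReal.ofReal (t ^ (l - 1))) z.1) =
          {z : ℝ × ℝ | z.1 < z.2}.indicator (fun z ↦ ENNReal.ofReal (z.1 ^ (l - 1))) := by
        ext z
        simp [indicator]
      exact this ▸ Measurable.indicator (by fun_prop)
        (measurableSet_lt measurable_fst measurable_snd)
    _ = _ := by
      rw [← lintegral_const_mul' _ _ ENNReal.ofReal_ne_top]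
      refine setLIntegral_congr_fun measurableSet_Ioi fun y (hy : 0 < y) ↦ ?_
      rw [lintegral_const_mul' _ _ ENNReal.ofReal_ne_top,
        lintegral_mul_const _ (Measurable.indicator (by fun_prop) measurableSet_Iio),
        lintegral_indicator measurableSet_Iio, Measure.restrict_restrict measurableSet_Iio,
        Iio_inter_Ioi, lintegral_Ioo_ofReal_rpow hl hy, hG]
      simp only
      rw [← mul_assoc, ← mul_assoc, ← mul_assoc, ← ENNReal.ofReal_mul (by positivity),
        ← ENNReal.ofReal_mul (by positivity), ← ENNReal.ofReal_mul (by positivity)]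
      congr 2
      rw [show (1 + l) * p - 1 = l + (1 + l) * (p - 1) by ring, Real.rpow_add hy,
        show 1 - p = -p + 1 by ring, Real.rpow_add hl, Real.rpow_one]
      field_simp

theorem weightedNorm_eq_lintegral {n : ℕ} {F : Type*} [NormedAddCommGroup F] [NormedSpace ℝ F]
    {s p : ℝ} (hp : 0 < p) (f : EuclideanSpace ℝ (Fin n) → F) :
    weightedNorm s p f = (∫⁻ x, ENNReal.ofReal (‖x‖ ^ (s * p)) * ‖f x‖ₑ ^ p) ^ (1 / p) := by
  rw [weightedNorm, eLpNorm_eq_lintegral_rpow_enorm_toReal (by simpa using hp)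
    ENNReal.ofReal_ne_top, ENNReal.toReal_ofReal hp.le]
  congr 1
  refine lintegral_congr fun x ↦ ?_
  rw [enorm_smul, ENNReal.mul_rpow_of_nonneg _ _ hp.le, Real.enorm_of_nonneg (by positivity),
    ENNReal.ofReal_rpow_of_nonneg (by positivity) hp.le, Real.rpow_mul (norm_nonneg x)]

/-! ### Transfer to radial functions on ℝⁿ -/

section Radial

variable {n : ℕ} {u : EuclideanSpace ℝ (Fin n) → ℝ}

theorem RadiallySymmetric.apply_eq (h : RadiallySymmetric u) {e : EuclideanSpace ℝ (Fin n)}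
    (he : ‖e‖ = 1) (x : EuclideanSpace ℝ (Fin n)) : u x = u (‖x‖ • e) :=
  h _ _ (by rw [norm_smul, he, norm_norm, mul_one])

/-- The radial derivative is dominated by the gradient. -/
theorem RadiallySymmetric.enorm_deriv_le_gradient (h : RadiallySymmetric u)
    (hu : Differentiable ℝ u) {e : EuclideanSpace ℝ (Fin n)} (he : ‖e‖ = 1)
    {x : EuclideanSpace ℝ (Fin n)} (hx : x ≠ 0) :
    ‖deriv (fun t : ℝ ↦ u (t • e)) ‖x‖‖ₑ ≤ ‖∇ u x‖ₑ := by
  have hx' : ‖x‖ ≠ 0 := norm_ne_zero_iff.2 hx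
  -- By symmetry the profile along e is also the profile along the ray through x.
  set v := ‖x‖⁻¹ • x with hv
  have hv1 : ‖v‖ = 1 := by rw [hv, norm_smul, norm_inv, norm_norm, inv_mul_cancel₀ hx']
  have hfun : (fun t : ℝ ↦ u (t • e)) = fun t : ℝ ↦ u (t • v) :=
    funext fun t ↦ h _ _ (by rw [norm_smul, norm_smul, he, hv1])
  have hxv : ‖x‖ • v = x := by rw [hv, smul_smul, mul_inv_cancel₀ hx', one_smul]
  have hd : HasDerivAt (fun t : ℝ ↦ u (t • v)) (fderiv ℝ u x v) ‖x‖ := by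
    have h1 : HasFDerivAt u (fderiv ℝ u x) (‖x‖ • v) := by
      rw [hxv]; exact (hu x).hasFDerivAt
    have h2 := h1.comp_hasDerivAt ‖x‖ ((hasDerivAt_id ‖x‖).smul_const v)
    rwa [one_smul] at h2
  rw [hfun, hd.deriv, ← inner_gradient_left, enorm_le_iff_norm_le]
  simpa [hv1] using norm_inner_le_norm (𝕜 := ℝ) (∇ u x) v

theorem HasCompactSupport.comp_smul_const (hc : HasCompactSupport u)
    {e : EuclideanSpace ℝ (Fin n)} (he : ‖e‖ = 1) :
    HasCompactSupport fun t : ℝ ↦ u (t • e) := by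
  refine hc.comp_isClosedEmbedding (g := fun t : ℝ ↦ t • e) ?_
  exact (Isometry.of_dist_eq fun s t ↦ by
    rw [dist_eq_norm, dist_eq_norm, ← sub_smul, norm_smul, he, mul_one]).isClosedEmbedding

/-- The weighted pointwise bound and Hardy's inequality for radial functions. -/
theorem exists_const_radial_hardy (hn : 1 ≤ n) {p α l : ℝ} (hp : 1 ≤ p) (hl : 0 < l)
    (hlα : (1 + l) * p = α * p + n) :
    ∃ c : ENNReal, c ≠ ⊤ ∧ ∀ u : EuclideanSpace ℝ (Fin n) → ℝ,
      ContDiff ℝ 1 u → HasCompactSupport u → RadiallySymmetric u →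
      (∀ x, ENNReal.ofReal (‖x‖ ^ (l * p)) * ‖u x‖ₑ ^ p ≤
        c * ∫⁻ x, ENNReal.ofReal (‖x‖ ^ (α * p)) * ‖∇ u x‖ₑ ^ p) ∧
      ∫⁻ x, ENNReal.ofReal (‖x‖ ^ (l * p - n)) * ‖u x‖ₑ ^ p ≤
        c * ∫⁻ x, ENNReal.ofReal (‖x‖ ^ (α * p)) * ‖∇ u x‖ₑ ^ p := by
  have : NeZero n := ⟨by omega⟩
  have hp0 : 0 < p := by linarith
  set e : EuclideanSpace ℝ (Fin n) := EuclideanSpace.single 0 1 with he_def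
  have he : ‖e‖ = 1 := by simp [he_def]
  set S := (volume : Measure (EuclideanSpace ℝ (Fin n))).toSphere Set.univ with hS
  have hS0 : S ≠ 0 := Measure.measure_univ_ne_zero.2 (Measure.toSphere_ne_zero _)
  have hSt : S ≠ ⊤ := measure_ne_top _ _
  -- The sphere's area S cancels in Hardy's inequality but not in the pointwise bound, where only
  -- the gradient side is integrated.
  refine ⟨max (ENNReal.ofReal (l ^ (1 - p)) * S⁻¹) (ENNReal.ofReal (l ^ (-p))), ?_,
    fun u hu hc hrad ↦ ?_⟩
  · exact (max_lt (ENNReal.mul_lt_top ENNReal.ofReal_lt_top (by simpa [pos_iff_ne_zero] using hS0))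
      ENNReal.ofReal_lt_top).ne
  set f : ℝ → ℝ := fun t ↦ u (t • e) with hf
  have hfc : ContDiff ℝ 1 f := hu.comp (contDiff_id.smul contDiff_const)
  have hfs : HasCompactSupport f := hc.comp_smul_const he
  have hfm : Measurable f := hfc.continuous.measurable
  have hdm : Measurable (deriv f) := measurable_deriv f
  have huf : ∀ x, u x = f ‖x‖ := hrad.apply_eq he
  have hpow : ∀ {s s' : ℝ}, s' = s + (n - 1) → ∀ g : ℝ → ENNReal, Measurable g →
      ∫⁻ x : EuclideanSpace ℝ (Fin n), ENNReal.ofReal (‖x‖ ^ s) * g ‖x‖ =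
        S * ∫⁻ t in Set.Ioi (0 : ℝ), ENNReal.ofReal (t ^ s') * g t := by
    intro s s' hs g hg
    rw [lintegral_fun_norm volume (f := fun t ↦ ENNReal.ofReal (t ^ s) * g t) (by fun_prop)]
    congr 1
    refine setLIntegral_congr_fun measurableSet_Ioi fun t (ht : 0 < t) ↦ ?_
    simp only [finrank_euclideanSpace, Fintype.card_fin]
    rw [← mul_assoc, ← ENNReal.ofReal_mul (by positivity), ← Real.rpow_natCast,
      ← Real.rpow_add ht, hs, Nat.cast_sub hn, Nat.cast_one, add_comm s]
  have hD : S * ∫⁻ t in Set.Ioi (0 : ℝ), ENNReal.ofReal (t ^ ((1 + l) * p - 1)) *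
      ‖deriv f t‖ₑ ^ p ≤ ∫⁻ x, ENNReal.ofReal (‖x‖ ^ (α * p)) * ‖∇ u x‖ₑ ^ p := by
    rw [← hpow (s := α * p) (by linarith) (fun t ↦ ‖deriv f t‖ₑ ^ p) (by fun_prop)]
    refine lintegral_mono_ae ?_
    filter_upwards [Measure.ae_ne volume (0 : EuclideanSpace ℝ (Fin n))] with x hx
    gcongr
    exact hrad.enorm_deriv_le_gradient (hu.differentiable one_ne_zero) he hx
  constructor
  · intro x
    rcases eq_or_ne x 0 with rfl | hx
    · simp [Real.zero_rpow (mul_pos hl hp0).ne']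
    rw [huf]
    refine (ofReal_rpow_mul_enorm_rpow_le hfc hfs hp hl (norm_pos_iff.2 hx)).trans ?_
    grw [← hD, ← le_max_left, mul_assoc, ← mul_assoc S⁻¹, ENNReal.inv_mul_cancel hS0 hSt, one_mul]
  · simp only [huf]
    rw [hpow (s' := l * p - 1) (by ring) (fun t ↦ ‖f t‖ₑ ^ p) (by fun_prop)]
    grw [lintegral_Ioi_rpow_mul_le_deriv hfc hfs hp hl, ← hD, ← le_max_right, mul_left_comm]

end Radial

/-! ### Interpolation -/

theorem theorem1p1 (n : ℕ) (hn : 1 ≤ n) (p q r a α β γ σ : ℝ)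
    (hp : 1 ≤ p) (hq : 1 ≤ q) (hr : 0 < r) (ha0 : 0 ≤ a) (ha1 : a ≤ 1)
    (hpα : 0 < 1 / p + α / n) (hqβ : 0 < 1 / q + β / n) (hrγ : 0 < 1 / r + γ / n)
    (hγ : γ = a * σ + (1 - a) * β)
    (hscale : 1 / r + γ / n = a * (1 / p + (α - 1) / n) + (1 - a) * (1 / q + β / n))
    (hr_lower : (1 - a) / q ≤ 1 / r) (hr_upper : 1 / r ≤ a / p + (1 - a) / q)
    (hασ_lower : 0 < a →
      ((n : ℝ) - 1) * ((1 / a) * (1 / r - 1 / q) + 1 / q - 1 / p) ≤ α - σ)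
    (hασ_upper : 0 < a → α - σ ≤ 0)
    (hασ_strict : 0 < a → p = 1 →
      ((n : ℝ) - 1) * ((1 / a) * (1 / r - 1 / q) + 1 / q - 1 / p) < α - σ)
    (hσ : 0 < a → -σ / n < (1 / a) * (1 / r - 1 / q) + 1 / q) :
    ∃ C : ℝ, 0 < C ∧
      ∀ u : EuclideanSpace ℝ (Fin n) → ℝ,
        ContDiff ℝ ∞ u → HasCompactSupport u → RadiallySymmetric u →
          weightedNorm γ r u ≤
            ENNReal.ofReal C * weightedNorm α p (∇ u) ^ a * weightedNorm β q u ^ (1 - a) := by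
  have hp0 : 0 < p := by linarith
  have hq0 : 0 < q := by linarith
  have hn0 : (0 : ℝ) < n := by exact_mod_cast hn
  rcases ha0.eq_or_lt with rfl | ha
  · have hrq : r = q := by
      have : 1 / r = 1 / q := le_antisymm (by simpa using hr_upper) (by simpa using hr_lower)
      simpa using this
    have hγβ : γ = β := by linarith
    exact ⟨1, one_pos, fun u _ _ _ ↦ by simp [hrq, hγβ]⟩
  set l := α - 1 + n / p with hl_def
  have hbal : n / r + γ = a * l + (1 - a) * (n / q + β) := by
    rw [hl_def]
    field_simp at hscale ⊢
    linarith
  -- Multiplied by a * n, the gap in `hσ` equals a * l, by `hγ` and `hbal`.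
  have hl : 0 < l := by
    have h := hσ ha
    have h2 : 0 < a * n * ((1 / a) * (1 / r - 1 / q) + 1 / q - -σ / n) :=
      mul_pos (mul_pos ha hn0) (sub_pos.2 h)
    have h3 : a * n * ((1 / a) * (1 / r - 1 / q) + 1 / q - -σ / n) =
        n / r - n / q + a * (n / q) + a * σ := by
      field_simp
      ring
    have h4 : 0 < a * l := by rw [h3] at h2; linarith
    exact pos_of_mul_pos_right h4 ha.le
  obtain ⟨c, hc, H⟩ := exists_const_radial_hardy (n := n) hn (α := α) hp hl
    (by rw [hl_def]; field_simp; ring)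
  refine ⟨(c ^ (a / p)).toReal + 1, by positivity, fun u hu hcs hrad ↦ ?_⟩
  obtain ⟨Hpt, Hint⟩ := H u (hu.of_le (by norm_cast)) hcs hrad
  have hum : Measurable u := hu.continuous.measurable
  rw [weightedNorm_eq_lintegral hr, weightedNorm_eq_lintegral hp0, weightedNorm_eq_lintegral hq0]
  set D := ∫⁻ x, ENNReal.ofReal (‖x‖ ^ (α * p)) * ‖∇ u x‖ₑ ^ p
  set B := ∫⁻ x, ENNReal.ofReal (‖x‖ ^ (β * q)) * ‖u x‖ₑ ^ q
  -- η is dictated by the power of the L^q norm. Then `hr_lower` gives η ≤ 1 and `hr_upper` gives κ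
  -- ≥ 0; κ is what remains of the gradient power a * r / p after Hardy takes 1 - η.
  set η := (1 - a) * r / q with hη
  have hη0 : 0 ≤ η := div_nonneg (mul_nonneg (by linarith) hr.le) hq0.le
  have hη1 : 0 ≤ 1 - η := by
    have := mul_le_mul_of_nonneg_right hr_lower hr.le
    rw [one_div_mul_cancel hr.ne'] at this
    have h2 : (1 - a) / q * r = η := by rw [hη]; ring
    linarith
  set κ := a * r / p - (1 - η) with hκ_def
  have hκ : 0 ≤ κ := by
    have := mul_le_mul_of_nonneg_right hr_upper hr.le
    rw [one_div_mul_cancel hr.ne'] at this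
    have h2 : (a / p + (1 - a) / q) * r = a * r / p + η := by rw [hη]; ring
    linarith
  have hexp_u : p * κ + p * (1 - η) + q * η = r := by
    rw [hκ_def, hη]; field_simp; ring
  -- The weights match because of the scaling identity.
  have hexp_x : l * p * κ + (l * p - n) * (1 - η) + β * q * η = γ * r := by
    have h1 : γ * r = (a * l + (1 - a) * (n / q + β)) * r - n := by
      rw [← hbal]; field_simp; ring
    rw [h1, hκ_def, hη]; field_simp; ring
  have hmain : ∫⁻ x, ENNReal.ofReal (‖x‖ ^ (γ * r)) * ‖u x‖ₑ ^ r ≤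
      (c * D) ^ (a * r / p) * B ^ η := by
    calc
      _ ≤ ∫⁻ x, (c * D) ^ κ *
          ((ENNReal.ofReal (‖x‖ ^ (l * p - n)) * ‖u x‖ₑ ^ p) ^ (1 - η) *
            (ENNReal.ofReal (‖x‖ ^ (β * q)) * ‖u x‖ₑ ^ q) ^ η) := by
        have : NeZero n := ⟨by omega⟩
        refine lintegral_mono_ae ?_
        filter_upwards [Measure.ae_ne volume (0 : EuclideanSpace ℝ (Fin n))] with x hx
        have hx0 : 0 < ‖x‖ := norm_pos_iff.2 hx
        have hpos := fun s ↦ Real.rpow_pos_of_pos hx0 s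
        grw [← Hpt x]
        refine le_of_eq ?_
        simp only [ENNReal.mul_rpow_of_nonneg _ _ hκ, ENNReal.mul_rpow_of_nonneg _ _ hη0,
          ENNReal.mul_rpow_of_nonneg _ _ hη1, ENNReal.ofReal_rpow_of_pos (hpos _),
          ← ENNReal.rpow_mul, ← Real.rpow_mul hx0.le]
        rw [← hexp_x, ← hexp_u, Real.rpow_add hx0, Real.rpow_add hx0,
          ENNReal.ofReal_mul (by positivity), ENNReal.ofReal_mul (by positivity),
          ENNReal.rpow_add_of_nonneg _ _ (by positivity) (by positivity),
          ENNReal.rpow_add_of_nonneg _ _ (by positivity) (by positivity)]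
        ring
      _ ≤ (c * D) ^ κ * ((c * D) ^ (1 - η) * B ^ η) := by
        rw [lintegral_const_mul _ (by fun_prop)]
        grw [ENNReal.lintegral_mul_norm_pow_le (by fun_prop) (by fun_prop) hη1 hη0 (by ring), Hint]
      _ = _ := by
        rw [← mul_assoc, ← ENNReal.rpow_add_of_nonneg _ _ hκ hη1, hκ_def, sub_add_cancel]
  grw [hmain]
  rw [ENNReal.mul_rpow_of_nonneg _ _ (by positivity), ← ENNReal.rpow_mul, ← ENNReal.rpow_mul,
    ← ENNReal.rpow_mul, ← ENNReal.rpow_mul, show a * r / p * (1 / r) = a / p by field_simp,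
    show η * (1 / r) = 1 / q * (1 - a) by rw [hη]; field_simp,
    ENNReal.mul_rpow_of_nonneg _ _ (by positivity), show 1 / p * a = a / p by ring]
  gcongr
  calc
    c ^ (a / p) = ENNReal.ofReal (c ^ (a / p)).toReal :=
      (ENNReal.ofReal_toReal (ENNReal.rpow_ne_top_of_nonneg (by positivity) hc)).symm
    _ ≤ _ := ENNReal.ofReal_le_ofReal (by linarith)
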